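/- Let \(\mathfrak T\) be a triangulated category with suspension \(\Sigma\), and let \(\mathfrak I\) be a homological ideal in \(\mathfrak T\), that is, an ideal of morphisms of the form \(\mathfrak I=\ker F=\{f \mid F(f)=0\}\) for a stable homological functor \(F\colon\mathfrak T\to\mathfrak A\) into an abelian category \(\mathfrak A\) equipped with a suspension (a homological functor together with a natural isomorphism \(F\Sigma\cong\Sigma F\)). For a chain complex \(C_\bullet=(\dotsb\to C_{n+1}\xrightarrow{d_{n+1}}C_n\xrightarrow{d_n}C_{n-1}\to\dotsb)\), indexed by \(n\in\mathbb Z\), over \(\mathfrak T\), embed each \(d_n\) in an exact triangle \(C_n\xrightarrow{d_n}C_{n-1}\xrightarrow{f_n}X_n\xrightarrow{g_n}\Sigma C_n\). The complex \(C_\bullet\) is called \(\mathfrak I\)-exact in degree \(n\) if the composite \(X_n\xrightarrow{g_n}\Sigma C_n\xrightarrow{\Sigma f_{n+1}}\Sigma X_{n+1}\) belongs to \(\mathfrak I\); this does not depend on the choice of the triangles. It is called \(\mathfrak I\)-exact if it is \(\mathfrak I\)-exact in all degrees. The \(\mathfrak I\)-exact chain complexes form a triangulated subcategory of the homotopy category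 \(\mathfrak{Ho}(\mathfrak T)\) of chain complexes over \(\mathfrak T\); let \(\mathfrak{Der}=\mathfrak{Der}(\mathfrak T,\mathfrak I)\) be the (Verdier) localisation of the triangulated category \(\mathfrak{Ho}(\mathfrak T)\) at this subcategory. For \(n\in\mathbb Z\), let \(\mathfrak{Der}^{\ge n}\) and \(\mathfrak{Der}^{\le n}\) be the full subcategories, closed under isomorphism, of \(\mathfrak{Der}\) of those chain complexes that are \(\mathfrak I\)-exact in all degrees less than \(n\) and in all degrees greater than \(n\), respectively. Theorem. The pair of subcategories \(\mathfrak{Der}^{\ge 0}\), \(\mathfrak{Der}^{\le 0}\) is a t-structure on \(\mathfrak{Der}\) in the sense of Beilinson, Bernstein and Deligne, whose shifts are the subcategories \(\mathfrak{Der}^{\ge n}\), \(\mathfrak{Der}^{\le n}\). That is: \(\Sigma^m\mathfrak{Der}^{\ge n}=\mathfrak{Der}^{\ge n+m}\) and \(\Sigma^m\mathfrak{Der}^{\le n}=\mathfrak{Der}^{\le n+m}\) for all \(m,n\in\mathbb Z\); \(\mathfrak{Der}^{\ge 0}\subseteq\mathfrak{Der}^{\ge -1}\) and \(\mathfrak{Der}^{\le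 -1}\subseteq\mathfrak{Der}^{\le 0}\); every morphism in \(\mathfrak{Der}\) from an object of \(\mathfrak{Der}^{\ge 0}\) to an object of \(\mathfrak{Der}^{\le -1}\) is zero; and every object \(C\) of \(\mathfrak{Der}\) sits in an exact triangle \(A\to C\to B\to\Sigma A\) with \(A\in\mathfrak{Der}^{\ge 0}\) and \(B\in\mathfrak{Der}^{\le -1}\). -/

import Mathlib

open CategoryTheory Category Limits Pretriangulated Triangulated

universe w' w v u

noncomputable section

namespace RelHomAlg

/-- An ideal in a preadditive category: a family of subgroups of the morphism groups
that is closed under composition with arbitrary morphisms on both sides. -/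
@[ext]
structure MorphismIdeal (C : Type u) [Category.{v} C] [Preadditive C] where
  /-- the subgroup of morphisms `A ⟶ B` that belong to the ideal -/
  hom (A B : C) : AddSubgroup (A ⟶ B)
  comp_mem {A B C' D : C} (f : A ⟶ B) (g : B ⟶ C') (h : C' ⟶ D) (hg : g ∈ hom B C') :
    f ≫ g ≫ h ∈ hom A D

/-- The kernel on morphisms of an additive functor. -/
def morphismKernel {C : Type u} [Category.{v} C] [Preadditive C] {D : Type w}
    [Category.{w'} D] [Preadditive D] (F : C ⥤ D) [F.Additive] : MorphismIdeal C where
  hom A B := (F.mapAddHom (X := A) (Y := B)).ker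
  comp_mem f g h hg := by
    rw [AddMonoidHom.mem_ker] at hg ⊢
    have hg' : F.map g = 0 := hg
    change F.map (f ≫ g ≫ h) = 0
    simp [hg']

section

variable {T : Type u} [Category.{v} T] [HasZeroObject T] [Preadditive T] [HasShift T ℤ]
  [∀ n : ℤ, (shiftFunctor T n).Additive] [Pretriangulated T]

/-- An ideal `I` in a triangulated category is homological if it is the kernel of a stable
homological functor, that is, of a homological functor `F` to an abelian category `A` with a
suspension `S`, such that `F` intertwines the suspensions up to a natural isomorphism.
(A self-equivalence `S` of an abelian category is automatically additive.) -/
def MorphismIdeal.IsHomological (I : MorphismIdeal T) : Prop :=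
  ∃ (A : Type w) (_ : Category.{w'} A) (_ : Abelian A) (S : A ≌ A) (F : T ⥤ A)
    (_ : F.IsHomological),
    Nonempty (shiftFunctor T (1 : ℤ) ⋙ F ≅ F ⋙ S.functor) ∧ I = morphismKernel F

variable (T) in
/-- A homological ideal in a triangulated category. The universe levels `w`, `w'` are those of
the abelian category in which a defining stable homological functor takes its values. -/
structure HomologicalIdeal extends MorphismIdeal T where
  isHomological : MorphismIdeal.IsHomological.{w', w} toMorphismIdeal

/-- A chain complex `⋯ ⟶ C_{n+1} ⟶ C_n ⟶ C_{n-1} ⟶ ⋯` is encoded as the cochain complex `K`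
with `K.X (-n) = C_n`, so that `d_n : C_n ⟶ C_{n-1}` is `K.d (-n) (-(n-1))`.

The complex is `I`-exact in (homological) degree `n` if, for distinguished triangles
`C_n --d_n--> C_{n-1} --f--> X --g--> C_n⟦1⟧` and
`C_{n+1} --d_{n+1}--> C_n --f'--> X' --g'--> C_{n+1}⟦1⟧`, the composite
`X --g--> C_n⟦1⟧ --f'⟦1⟧--> X'⟦1⟧` belongs to `I`. -/
def IsExactInDegree (I : MorphismIdeal T) (K : CochainComplex T ℤ) (n : ℤ) : Prop :=
  ∃ (X X' : T) (f : K.X (-(n - 1)) ⟶ X) (g : X ⟶ (K.X (-n))⟦(1 : ℤ)⟧)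
    (f' : K.X (-n) ⟶ X') (g' : X' ⟶ (K.X (-(n + 1)))⟦(1 : ℤ)⟧),
    Triangle.mk (K.d (-n) (-(n - 1))) f g ∈ distTriang T ∧
    Triangle.mk (K.d (-(n + 1)) (-n)) f' g' ∈ distTriang T ∧
    g ≫ f'⟦(1 : ℤ)⟧' ∈ I.hom X (X'⟦(1 : ℤ)⟧)

lemma exact_aux {A : Type w} [Category.{w'} A] [Abelian A] {Y Z B W V : A}
    {u : Y ⟶ Z} {d₀ : Z ⟶ B} {d₁ : W ⟶ Z} {f : Z ⟶ V}
    (h₁ : ∃ w, (ShortComplex.mk u d₀ w).Exact) (h₂ : ∃ w, (ShortComplex.mk d₁ f w).Exact)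
    (w : d₁ ≫ d₀ = 0) : u ≫ f = 0 ↔ (ShortComplex.mk d₁ d₀ w).Exact := by
  obtain ⟨w₁, h₁⟩ := h₁
  obtain ⟨w₂, h₂⟩ := h₂
  rw [ShortComplex.exact_iff_exact_up_to_refinements] at h₁ h₂ ⊢
  dsimp at h₁ h₂ ⊢
  constructor
  · intro h P x hx
    obtain ⟨P', π, hπ, y, hy⟩ := h₁ x hx
    obtain ⟨P'', π', hπ', z, hz⟩ := h₂ (π ≫ x) (by simp [hy, h])
    exact ⟨P'', π' ≫ π, inferInstance, z, by simpa using hz⟩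
  · intro h
    obtain ⟨P, π, hπ, y, hy⟩ := h u w₁
    rw [← cancel_epi π, ← assoc, hy, assoc, w₂, comp_zero, comp_zero]

/-- Independence of the choice of the triangles, and comparison with exactness after applying
a stable homological functor. -/
lemma exact_iff_of_triangles {A : Type w} [Category.{w'} A] [Abelian A] (S : A ≌ A) (F : T ⥤ A)
    [F.IsHomological] (e : shiftFunctor T (1 : ℤ) ⋙ F ≅ F ⋙ S.functor)
    {Y Z B X X' : T} {d₁ : Y ⟶ Z} {d₀ : Z ⟶ B} {f : B ⟶ X} {g : X ⟶ Z⟦(1 : ℤ)⟧}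
    {f' : Z ⟶ X'} {g' : X' ⟶ Y⟦(1 : ℤ)⟧}
    (h₀ : Triangle.mk d₀ f g ∈ distTriang T) (h₁ : Triangle.mk d₁ f' g' ∈ distTriang T)
    (w : F.map d₁ ≫ F.map d₀ = 0) :
    F.map (g ≫ f'⟦(1 : ℤ)⟧') = 0 ↔ (ShortComplex.mk (F.map d₁) (F.map d₀) w).Exact := by
  have h₃ : ∃ w, (ShortComplex.mk (F.map g) (F.map (-d₀⟦(1 : ℤ)⟧')) w).Exact :=
    ⟨_, F.map_distinguished_exact _ (rot_of_distTriang _ (rot_of_distTriang _ h₀))⟩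
  have h₄ : ∃ w, (ShortComplex.mk (F.map (-d₁⟦(1 : ℤ)⟧')) (F.map (-f'⟦(1 : ℤ)⟧')) w).Exact :=
    ⟨_, F.map_distinguished_exact _
      (rot_of_distTriang _ (rot_of_distTriang _ (rot_of_distTriang _ h₁)))⟩
  have n₁ : F.map (d₁⟦(1 : ℤ)⟧') ≫ e.hom.app Z = e.hom.app Y ≫ S.functor.map (F.map d₁) :=
    e.hom.naturality d₁
  have n₀ : F.map (d₀⟦(1 : ℤ)⟧') ≫ e.hom.app B = e.hom.app Z ≫ S.functor.map (F.map d₀) :=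
    e.hom.naturality d₀
  have w' : F.map (-d₁⟦(1 : ℤ)⟧') ≫ F.map (-d₀⟦(1 : ℤ)⟧') = 0 := by
    rw [F.map_neg, F.map_neg, Preadditive.neg_comp_neg, ← cancel_mono (e.hom.app _), assoc, n₀,
      reassoc_of% n₁, ← S.functor.map_comp, w]
    simp
  have h₅ : F.map (g ≫ f'⟦(1 : ℤ)⟧') = 0 ↔ F.map g ≫ F.map (-f'⟦(1 : ℤ)⟧') = 0 := by
    rw [F.map_neg, Preadditive.comp_neg, neg_eq_zero, F.map_comp]
  rw [h₅, exact_aux h₃ h₄ w', ← ShortComplex.exact_map_iff_of_faithful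
    (ShortComplex.mk (F.map d₁) (F.map d₀) w) S.functor]
  let i : F.obj (Z⟦(1 : ℤ)⟧) ≅ S.functor.obj (F.obj Z) :=
    ⟨-e.hom.app Z, -e.inv.app Z,
      by rw [Preadditive.neg_comp_neg]; exact e.hom_inv_id_app Z,
      by rw [Preadditive.neg_comp_neg]; exact e.inv_hom_id_app Z⟩
  refine ShortComplex.exact_iff_of_iso (ShortComplex.isoMk (e.app Y) i (e.app B) ?_ ?_)
  · change e.hom.app Y ≫ S.functor.map (F.map d₁) = F.map (-d₁⟦(1 : ℤ)⟧') ≫ (-e.hom.app Z)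
    rw [F.map_neg, Preadditive.neg_comp_neg, n₁]
  · change (-e.hom.app Z) ≫ S.functor.map (F.map d₀) = F.map (-d₀⟦(1 : ℤ)⟧') ≫ e.hom.app B
    rw [F.map_neg, Preadditive.neg_comp, Preadditive.neg_comp, n₀]

lemma isExactInDegree_iff {I : MorphismIdeal T} {A : Type w} [Category.{w'} A] [Abelian A]
    (S : A ≌ A) (F : T ⥤ A) [F.IsHomological]
    (e : shiftFunctor T (1 : ℤ) ⋙ F ≅ F ⋙ S.functor) (hI : I = morphismKernel F)
    (K : CochainComplex T ℤ) (n : ℤ) :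
    IsExactInDegree I K n ↔
      ((F.mapHomologicalComplex (ComplexShape.up ℤ)).obj K).ExactAt (-n) := by
  rw [HomologicalComplex.exactAt_iff' _ (-(n + 1)) (-n) (-(n - 1)) (by simp; lia) (by simp; lia)]
  have hmem : ∀ {X Y : T} (f : X ⟶ Y), f ∈ I.hom X Y ↔ F.map f = 0 := by
    rintro X Y f
    subst hI
    exact Iff.rfl
  have w : F.map (K.d (-(n + 1)) (-n)) ≫ F.map (K.d (-n) (-(n - 1))) = 0 := by
    rw [← F.map_comp, K.d_comp_d, F.map_zero]
  constructor
  · rintro ⟨X, X', f, g, f', g', h₀, h₁, h⟩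
    exact (exact_iff_of_triangles S F e h₀ h₁ w).1 ((hmem _).1 h)
  · intro h
    obtain ⟨X, f, g, h₀⟩ := distinguished_cocone_triangle (K.d (-n) (-(n - 1)))
    obtain ⟨X', f', g', h₁⟩ := distinguished_cocone_triangle (K.d (-(n + 1)) (-n))
    exact ⟨X, X', f, g, f', g', h₀, h₁,
      (hmem _).2 ((exact_iff_of_triangles S F e h₀ h₁ w).2 h)⟩

variable (T) in
/-- The homotopy category of chain complexes over `T`. -/
abbrev Ho := HomotopyCategory T (ComplexShape.up ℤ)

/-- The full subcategory of `Ho T` of the `I`-exact chain complexes. -/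
def exactComplexes (I : MorphismIdeal T) : ObjectProperty (Ho T) :=
  fun K => ∀ n : ℤ, IsExactInDegree I K.as n

/-- The `I`-exact chain complexes form a triangulated subcategory of `Ho T`. -/
instance (I : HomologicalIdeal.{w', w} T) :
    (exactComplexes I.toMorphismIdeal).IsTriangulated := by
  obtain ⟨A, _, _, S, F, _, ⟨e⟩, hI⟩ := I.isHomological
  have : exactComplexes I.toMorphismIdeal =
      (HomotopyCategory.subcategoryAcyclic A).inverseImage
        (F.mapHomotopyCategory (ComplexShape.up ℤ)) := by
    ext K
    obtain ⟨K, rfl⟩ := HomotopyCategory.quotient_obj_surjective K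
    rw [ObjectProperty.prop_inverseImage_iff]
    change _ ↔ HomotopyCategory.subcategoryAcyclic A
      ((HomotopyCategory.quotient _ _).obj ((F.mapHomologicalComplex _).obj K))
    rw [HomotopyCategory.quotient_obj_mem_subcategoryAcyclic_iff_acyclic]
    constructor
    · intro h n
      simpa using (isExactInDegree_iff S F e hI K (-n)).1 (h (-n))
    · intro h n
      exact (isExactInDegree_iff S F e hI K n).2 (h (-n))
  rw [this]
  infer_instance

/-- The derived category of `T` with respect to `I`: the localization of `Ho T` at the
triangulated subcategory of `I`-exact chain complexes, that is, at the morphisms whose cone is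
`I`-exact. It carries the triangulated structure of a Verdier quotient. -/
abbrev Der (I : HomologicalIdeal.{w', w} T) : Type (max u v) :=
  (exactComplexes I.toMorphismIdeal).trW.Localization

/-- The chain complex `K`, as an object of the derived category. -/
abbrev Der.ofComplex (I : HomologicalIdeal.{w', w} T) (K : CochainComplex T ℤ) : Der I :=
  (exactComplexes I.toMorphismIdeal).trW.Q.obj
    ((HomotopyCategory.quotient T (ComplexShape.up ℤ)).obj K)

/-- The (strictly full) subcategory `Der^{≥ n}` of chain complexes that are `I`-exact in
homological degrees less than `n`. -/
def derGE (I : HomologicalIdeal.{w', w} T) (n : ℤ) : ObjectProperty (Der I) :=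
  fun X => ∃ K : CochainComplex T ℤ, Nonempty (X ≅ Der.ofComplex I K) ∧
    ∀ m : ℤ, m < n → IsExactInDegree I.toMorphismIdeal K m

/-- The (strictly full) subcategory `Der^{≤ n}` of chain complexes that are `I`-exact in
homological degrees greater than `n`. -/
def derLE (I : HomologicalIdeal.{w', w} T) (n : ℤ) : ObjectProperty (Der I) :=
  fun X => ∃ K : CochainComplex T ℤ, Nonempty (X ≅ Der.ofComplex I K) ∧
    ∀ m : ℤ, n < m → IsExactInDegree I.toMorphismIdeal K m

end

end RelHomAlg

end

/-! Choose a stable homological functor `F` with kernel `I`. Exactness in homological degree `n`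
means that the homology of `F(K)` vanishes in cohomological degree `-n`, so `Der` localises `Ho T`
at the maps that induce isomorphisms on all this relative homology. No kernels are available in `T`,
so complexes cannot be truncated naively, but weak kernels suffice.

Keep `K` in cohomological degrees `≥ 0` and continue it to the left by iterated weak kernels of `K.d
0 1`. In the result `L` every cycle in degree `≤ 0`, with any source object in `T`, is a boundary.
Hence `F(L)` is exact there, and chain maps and homotopies into `L` can be built by descending
induction from their values in degrees `≥ 0`. The identity in degrees `≥ 0` thus extends to `π : K ⟶
L`, an isomorphism on relative homology in positive degrees; the fibre of `π` gives the truncation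
triangle (`Detects.exists_triangle`).

For orthogonality (`Detects.hom_eq_zero`), replace the target by its truncation and write the
morphism as a fraction. Its numerator factors, up to homotopy, through the truncation of its source,
which is exact everywhere and so zero in `Der`. -/

noncomputable section

/-! ### Descending constructions of chain maps and homotopies -/

namespace CochainComplex

variable {V : Type u} [Category.{v} V] [Preadditive V]

/-- Every morphism to `K.X j` that is killed by `K.d j k` factors through `K.d i j`. -/
def HasCycleLifts (K : CochainComplex V ℤ) (i j k : ℤ) : Prop :=
  ∀ ⦃W : V⦄ (x : W ⟶ K.X j), x ≫ K.d j k = 0 → ∃ y : W ⟶ K.X i, y ≫ K.d i j = x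

open Classical in
/-- A factorization of `x` through the differential `K.d i j`, or zero if there is none. -/
def cycleLift (K : CochainComplex V ℤ) (i j : ℤ) {W : V} (x : W ⟶ K.X j) : W ⟶ K.X i :=
  if h : ∃ y : W ⟶ K.X i, y ≫ K.d i j = x then h.choose else 0

lemma HasCycleLifts.cycleLift_d {K : CochainComplex V ℤ} {i j k : ℤ} (hK : K.HasCycleLifts i j k)
    {W : V} (x : W ⟶ K.X j) (hx : x ≫ K.d j k = 0) : K.cycleLift i j x ≫ K.d i j = x := by
  have h := hK x hx
  rw [cycleLift, dif_pos h]
  exact h.choose_spec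

/-- The downward extension to all degrees of the components in nonnegative degrees of a
morphism of complexes. -/
def extendDown {K L : CochainComplex V ℤ} (g : ∀ i, K.X i ⟶ L.X i) (i : ℤ) : K.X i ⟶ L.X i :=
  if 0 ≤ i then g i else L.cycleLift i (i + 1) (K.d i (i + 1) ≫ extendDown g (i + 1))
termination_by (-i).toNat

lemma extendDown_of_nonneg {K L : CochainComplex V ℤ} (g : ∀ i, K.X i ⟶ L.X i) (i : ℤ)
    (hi : 0 ≤ i) : extendDown g i = g i := by
  rw [extendDown, if_pos hi]

/-- Commutation one degree higher makes the map to be lifted a cycle, so the induction descends from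
degree 0. -/
lemma extendDown_comm {K L : CochainComplex V ℤ} (g : ∀ i, K.X i ⟶ L.X i)
    (hg : ∀ i, 0 ≤ i → g i ≫ L.d i (i + 1) = K.d i (i + 1) ≫ g (i + 1))
    (hL : ∀ i, i < 0 → L.HasCycleLifts i (i + 1) (i + 1 + 1)) (i : ℤ) :
    extendDown g i ≫ L.d i (i + 1) = K.d i (i + 1) ≫ extendDown g (i + 1) := by
  by_cases hi : 0 ≤ i
  · rw [extendDown_of_nonneg g i hi, extendDown_of_nonneg g (i + 1) (by lia), hg i hi]
  · have h := extendDown_comm g hg hL (i + 1)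
    rw [extendDown, if_neg hi]
    exact (hL i (by lia)).cycleLift_d _ (by rw [assoc, h, K.d_comp_d_assoc, zero_comp])
termination_by (-i).toNat

/-- A morphism of complexes that is given in nonnegative degrees extends to all degrees if cycles
of the target lift in the remaining degrees. -/
lemma exists_hom_extending {K L : CochainComplex V ℤ} (g : ∀ i, K.X i ⟶ L.X i)
    (hg : ∀ i, 0 ≤ i → g i ≫ L.d i (i + 1) = K.d i (i + 1) ≫ g (i + 1))
    (hL : ∀ i, i < 0 → L.HasCycleLifts i (i + 1) (i + 1 + 1)) :
    ∃ φ : K ⟶ L, ∀ i, 0 ≤ i → φ.f i = g i :=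
  ⟨{ f := extendDown g
     comm' := by
      rintro i _ rfl
      exact extendDown_comm g hg hL i }, extendDown_of_nonneg g⟩

/-- The null homotopy, built by descending induction, of a morphism of complexes that vanishes in
nonnegative degrees. -/
def nullHomotopyDown {K L : CochainComplex V ℤ} (φ : K ⟶ L) (i j : ℤ) : K.X i ⟶ L.X j :=
  if 0 ≤ i then 0 else
    L.cycleLift j i (φ.f i - K.d i (i + 1) ≫ nullHomotopyDown φ (i + 1) i)
termination_by (-i).toNat

lemma nullHomotopyDown_spec {K L : CochainComplex V ℤ} (φ : K ⟶ L)
    (hφ : ∀ i, 0 ≤ i → φ.f i = 0)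
    (hL : ∀ i, i < 0 → L.HasCycleLifts i (i + 1) (i + 1 + 1)) (j i : ℤ) (hij : j + 1 = i) :
    φ.f i = K.d i (i + 1) ≫ nullHomotopyDown φ (i + 1) i + nullHomotopyDown φ i j ≫ L.d j i := by
  by_cases hi : 0 ≤ i
  · rw [hφ i hi, nullHomotopyDown, if_pos (by lia), nullHomotopyDown, if_pos hi]
    simp
  · have h := nullHomotopyDown_spec φ hφ hL i (i + 1) rfl
    -- The homotopy identity in degree `i + 1` is what makes this difference a cycle.
    have hc : (φ.f i - K.d i (i + 1) ≫ nullHomotopyDown φ (i + 1) i) ≫ L.d i (i + 1) = 0 := by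
      rw [Preadditive.sub_comp, φ.comm, h]
      simp
    have hl : L.HasCycleLifts j i (i + 1) := by
      subst hij
      exact hL j (by lia)
    rw [nullHomotopyDown.eq_1 φ i j, if_neg hi, hl.cycleLift_d _ hc]
    abel
termination_by (-i).toNat

/-- A morphism of complexes that vanishes in nonnegative degrees is null homotopic if cycles of
the target lift in the remaining degrees. -/
lemma nonempty_homotopy_zero {K L : CochainComplex V ℤ} (φ : K ⟶ L)
    (hφ : ∀ i, 0 ≤ i → φ.f i = 0)
    (hL : ∀ i, i < 0 → L.HasCycleLifts i (i + 1) (i + 1 + 1)) : Nonempty (Homotopy φ 0) :=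
  ⟨{ hom := fun i j => if j + 1 = i then nullHomotopyDown φ i j else 0
     zero := fun i j h => if_neg h
     comm := fun i => by
      rw [dNext_eq _ (show (ComplexShape.up ℤ).Rel i (i + 1) from rfl),
        prevD_eq _ (show (ComplexShape.up ℤ).Rel (i - 1) i from sub_add_cancel i 1),
        if_pos rfl, if_pos (sub_add_cancel i 1)]
      simpa using nullHomotopyDown_spec φ hφ hL (i - 1) i (sub_add_cancel i 1) }⟩

/-- If `π` is invertible in nonnegative degrees and cycles of `M` lift in negative degrees, then
any morphism to `M` factors through `π` up to homotopy. -/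
lemma exists_factorization_up_to_homotopy {K L M : CochainComplex V ℤ} (π : K ⟶ L)
    (hπ : ∀ i, 0 ≤ i → IsIso (π.f i)) (f : K ⟶ M)
    (hM : ∀ i, i < 0 → M.HasCycleLifts i (i + 1) (i + 1 + 1)) :
    ∃ g : L ⟶ M, Nonempty (Homotopy (π ≫ g) f) := by
  classical
  obtain ⟨g, hg⟩ := exists_hom_extending (K := L) (L := M)
    -- Only degrees `≥ 0` matter here; the value 0 elsewhere is discarded by the extension.
    (fun i => if h : IsIso (π.f i) then inv (π.f i) ≫ f.f i else 0) (fun i hi => by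
      have := hπ i hi
      have := hπ (i + 1) (by lia)
      rw [dif_pos (hπ i hi), dif_pos (hπ (i + 1) (by lia)), ← cancel_epi (π.f i)]
      simp) hM
  obtain ⟨h⟩ := nonempty_homotopy_zero (π ≫ g - f) (fun i hi => by
    have := hπ i hi
    simp [hg i hi, this]) hM
  exact ⟨g, ⟨Homotopy.equivSubZero.symm h⟩⟩

/-! ### Truncation by iterated weak kernels -/

section

variable [HasWeakKernels V]

/-- The sequence of iterated weak kernels of a morphism. -/
def iteratedWeakKernel {X Y : V} (f : X ⟶ Y) : ℕ → Arrow V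
  | 0 => Arrow.mk f
  | n + 1 => Arrow.mk (weakKernel.ι (iteratedWeakKernel f n).hom)

/-- The complex of iterated weak kernels of a morphism. -/
def weakKernelComplex {X Y : V} (f : X ⟶ Y) : ChainComplex V ℕ :=
  ChainComplex.of (fun n => (iteratedWeakKernel f (n + 1)).left)
    (fun n => (iteratedWeakKernel f (n + 2)).hom)
    (fun n => weakKernel.condition (iteratedWeakKernel f (n + 2)).hom)

lemma weakKernelComplex_d {X Y : V} (f : X ⟶ Y) (n : ℕ) :
    (weakKernelComplex f).d (n + 1) n = (iteratedWeakKernel f (n + 2)).hom :=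
  ChainComplex.of_d (fun n => (iteratedWeakKernel f (n + 1)).left)
    (fun n => (iteratedWeakKernel f (n + 2)).hom) n

variable (K : CochainComplex V ℤ)

/-- The part of a complex in nonnegative degrees. -/
@[simps]
def nonnegPart : CochainComplex V ℕ where
  X n := K.X n
  d i j := K.d i j
  shape i j h := K.shape _ _ (fun h' => h (by simp at h' ⊢; lia))

/-- The data that connects the nonnegative part of `K` to the iterated weak kernels of `K.d 0 1`. -/
def weakTruncData : ConnectData (weakKernelComplex (K.d 0 1)) K.nonnegPart where
  d₀ := weakKernel.ι (K.d 0 1)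
  comp_d₀ := by
    rw [weakKernelComplex_d]
    exact weakKernel.condition (weakKernel.ι (K.d 0 1))
  d₀_comp := weakKernel.condition (K.d 0 1)

/-- The complex `K` in nonnegative degrees, continued by iterated weak kernels. -/
def weakTrunc : CochainComplex V ℤ := K.weakTruncData.cochainComplex

lemma hasCycleLifts_weakTrunc (i : ℤ) (hi : i < 0) :
    K.weakTrunc.HasCycleLifts i (i + 1) (i + 1 + 1) := by
  suffices ∀ i j k : ℤ, i + 1 = j → j + 1 = k → i < 0 → K.weakTrunc.HasCycleLifts i j k from
    this i _ _ rfl rfl hi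
  intro i j k hij hjk hi W x hx
  obtain ⟨n, rfl⟩ := Int.eq_negSucc_of_lt_zero hi
  -- The differential leaving degree `j` is `K.d 0 1` for `j = 0`, the gluing map for `j = -1`, and
  -- one of the later weak kernels for `j ≤ -2`.
  obtain _ | _ | n := n
  · obtain rfl : j = 0 := by lia
    obtain rfl : k = 1 := by lia
    have hx' : (show W ⟶ K.X 0 from x) ≫ K.d 0 1 = 0 := hx
    exact ⟨weakKernel.lift _ _ hx', weakKernel.lift_ι _ _ hx'⟩
  · obtain rfl : j = Int.negSucc 0 := by lia
    obtain rfl : k = 0 := by lia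
    have hx' : (show W ⟶ weakKernel (K.d 0 1) from x) ≫ weakKernel.ι (K.d 0 1) = 0 := hx
    refine ⟨weakKernel.lift _ _ hx', ?_⟩
    change _ ≫ (weakKernelComplex (K.d 0 1)).d 1 0 = _
    rw [weakKernelComplex_d]
    exact weakKernel.lift_ι _ _ hx'
  · obtain rfl : j = Int.negSucc (n + 1) := by lia
    obtain rfl : k = Int.negSucc n := by lia
    change x ≫ (weakKernelComplex (K.d 0 1)).d (n + 1) n = 0 at hx
    rw [weakKernelComplex_d] at hx
    have hx' : (show W ⟶ (iteratedWeakKernel (K.d 0 1) (n + 2)).left from x) ≫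
      (iteratedWeakKernel (K.d 0 1) (n + 2)).hom = 0 := hx
    refine ⟨weakKernel.lift _ _ hx', ?_⟩
    change _ ≫ (weakKernelComplex (K.d 0 1)).d (n + 2) (n + 1) = _
    rw [weakKernelComplex_d]
    exact weakKernel.lift_ι _ _ hx'

/-- Every complex maps to a complex whose cycles lift in negative degrees, by a morphism that is
invertible in nonnegative degrees. -/
lemma exists_weakTrunc : ∃ (L : CochainComplex V ℤ) (π : K ⟶ L),
    (∀ i, 0 ≤ i → IsIso (π.f i)) ∧
      ∀ i, i < 0 → L.HasCycleLifts i (i + 1) (i + 1 + 1) := by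
  obtain ⟨π, hπ⟩ := exists_hom_extending (K := K) (L := K.weakTrunc)
    (fun | Int.ofNat n => 𝟙 (K.X n) | Int.negSucc n => 0) (fun i hi => by
      obtain ⟨n, rfl⟩ := Int.eq_ofNat_of_zero_le hi
      exact (id_comp (K.d n (n + 1))).trans (comp_id (K.d n (n + 1))).symm)
    K.hasCycleLifts_weakTrunc
  refine ⟨K.weakTrunc, π, fun i hi => ?_, K.hasCycleLifts_weakTrunc⟩
  rw [hπ i hi]
  obtain ⟨n, rfl⟩ := Int.eq_ofNat_of_zero_le hi
  exact inferInstanceAs (IsIso (𝟙 (K.X n)))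

end

end CochainComplex

namespace RelHomAlg

variable {T : Type u} [Category.{v} T] [HasZeroObject T] [Preadditive T] [HasShift T ℤ]
  [∀ n : ℤ, (shiftFunctor T n).Additive] [Pretriangulated T]

/-! ### Relative homology and its invariance in the derived category -/

section

variable {A : Type w} [Category.{w'} A] [Abelian A] (F : T ⥤ A) [F.IsHomological]

/-- The homology in cohomological degree `n` of the image of a complex under `F`. -/
abbrev relHomology (n : ℤ) : Ho T ⥤ A :=
  F.mapHomotopyCategory (ComplexShape.up ℤ) ⋙
    HomotopyCategory.homologyFunctor A (ComplexShape.up ℤ) n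

/-- The relative homology of a complex is the homology of its image. -/
def relHomologyIso (n : ℤ) (K : CochainComplex T ℤ) :
    (relHomology F n).obj ((HomotopyCategory.quotient T _).obj K) ≅
      ((F.mapHomologicalComplex (ComplexShape.up ℤ)).obj K).homology n :=
  (HomotopyCategory.homologyFunctorFactors A (ComplexShape.up ℤ) n).app
    ((F.mapHomologicalComplex (ComplexShape.up ℤ)).obj K)

lemma isZero_relHomology_iff (n : ℤ) (K : CochainComplex T ℤ) :
    IsZero ((relHomology F n).obj ((HomotopyCategory.quotient T _).obj K)) ↔
      ((F.mapHomologicalComplex (ComplexShape.up ℤ)).obj K).ExactAt n := by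
  rw [HomologicalComplex.exactAt_iff_isZero_homology, (relHomologyIso F n K).isZero_iff]

lemma isIso_relHomology_map {K L : CochainComplex T ℤ} (φ : K ⟶ L) (n : ℤ)
    (h₀ : IsIso (φ.f (n - 1))) (h₁ : IsIso (φ.f n)) (h₂ : IsIso (φ.f (n + 1))) :
    IsIso ((relHomology F n).map ((HomotopyCategory.quotient T _).map φ)) := by
  have : QuasiIsoAt ((F.mapHomologicalComplex (ComplexShape.up ℤ)).map φ) n := by
    rw [quasiIsoAt_iff' _ (n - 1) n (n + 1) (by simp) (by simp)]
    let ψ := (HomologicalComplex.shortComplexFunctor' A (ComplexShape.up ℤ)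
      (n - 1) n (n + 1)).map ((F.mapHomologicalComplex (ComplexShape.up ℤ)).map φ)
    have : IsIso ψ.τ₁ := inferInstanceAs (IsIso (F.map (φ.f (n - 1))))
    have : IsIso ψ.τ₂ := inferInstanceAs (IsIso (F.map (φ.f n)))
    have : IsIso ψ.τ₃ := inferInstanceAs (IsIso (F.map (φ.f (n + 1))))
    exact ShortComplex.quasiIso_of_epi_of_isIso_of_mono ψ
  rw [quasiIsoAt_iff_isIso_homologyMap] at this
  exact (NatIso.isIso_map_iff (HomotopyCategory.homologyFunctorFactors A (ComplexShape.up ℤ) n)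
    ((F.mapHomologicalComplex (ComplexShape.up ℤ)).map φ)).2 this

/-- The fibre of `K.d n (n + 1)` maps to `K.X n` by a cycle, which lifts through `K.d (n - 1) n`.
Since `F` is homological, the image of this fibre covers the kernel of the image of `K.d n (n + 1)`.
-/
lemma isZero_relHomology_of_hasCycleLifts (K : CochainComplex T ℤ) (n : ℤ)
    (hK : K.HasCycleLifts (n - 1) n (n + 1)) :
    IsZero ((relHomology F n).obj ((HomotopyCategory.quotient T _).obj K)) := by
  rw [isZero_relHomology_iff, HomologicalComplex.exactAt_iff' _ (n - 1) n (n + 1)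
    (by simp) (by simp)]
  obtain ⟨N, f, g, hT⟩ := distinguished_cocone_triangle₁ (K.d n (n + 1))
  obtain ⟨y, hy⟩ := hK f (comp_distTriang_mor_zero₁₂ _ hT)
  have hex := F.map_distinguished_exact _ hT
  rw [ShortComplex.exact_iff_exact_up_to_refinements] at hex ⊢
  intro P x hx
  obtain ⟨P', π, hπ, z, hz⟩ := hex x hx
  have hf : F.map f = F.map y ≫ F.map (K.d (n - 1) n) := by rw [← F.map_comp, hy]
  change P' ⟶ F.obj N at z
  exact ⟨P', π, hπ, z ≫ F.map y, hz.trans ((z ≫= hf).trans (assoc _ _ _).symm)⟩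

/-- Relative homology and the shift. -/
def relHomologyShiftIso (X : Ho T) (a n n' : ℤ) (h : a + n = n') :
    (relHomology F n).obj (X⟦a⟧) ≅ (relHomology F n').obj X :=
  (HomotopyCategory.homologyFunctor A (ComplexShape.up ℤ) n).mapIso
    (((F.mapHomotopyCategory (ComplexShape.up ℤ)).commShiftIso a).app X) ≪≫
  ((HomotopyCategory.homologyFunctor A (ComplexShape.up ℤ) 0).shiftIso a n n' h).app
    ((F.mapHomotopyCategory (ComplexShape.up ℤ)).obj X)

/-- In the long exact sequence, the two hypotheses kill the maps into and out of this homology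
object. -/
lemma isZero_relHomology_obj₁ {t : Triangle (Ho T)} (ht : t ∈ distTriang (Ho T)) (n₀ n₁ : ℤ)
    (h : n₀ + 1 = n₁) (h₀ : Epi ((relHomology F n₀).map t.mor₂))
    (h₁ : Mono ((relHomology F n₁).map t.mor₂)) : IsZero ((relHomology F n₁).obj t.obj₁) := by
  let H := HomotopyCategory.homologyFunctor A (ComplexShape.up ℤ) 0
  have ht' := (F.mapHomotopyCategory (ComplexShape.up ℤ)).map_distinguished t ht
  have e₀ := (H.homologySequence_epi_shift_map_mor₂_iff _ ht' n₀ n₁ h).1 h₀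
  have e₁ := (H.homologySequence_mono_shift_map_mor₂_iff _ ht' n₁).1 h₁
  exact (H.homologySequence_exact₁ _ ht' n₀ n₁ h).isZero_of_both_zeros e₀ e₁

variable {F} {I : HomologicalIdeal.{w', w} T}

/-- The `I`-exactness of complexes is detected by the functor `F`. -/
def Detects (F : T ⥤ A) [F.IsHomological] (I : MorphismIdeal T) : Prop :=
  ∀ (K : CochainComplex T ℤ) (n : ℤ), IsExactInDegree I K n ↔
    IsZero ((relHomology F (-n)).obj ((HomotopyCategory.quotient T _).obj K))

variable (hF : Detects F I.toMorphismIdeal)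

include hF

lemma Detects.exactComplexes_eq :
    exactComplexes I.toMorphismIdeal = (HomotopyCategory.subcategoryAcyclic A).inverseImage
      (F.mapHomotopyCategory (ComplexShape.up ℤ)) := by
  ext X
  rw [ObjectProperty.prop_inverseImage_iff, HomotopyCategory.mem_subcategoryAcyclic_iff]
  obtain ⟨K, rfl⟩ := HomotopyCategory.quotient_obj_surjective X
  refine ⟨fun h n => ?_, fun h n => (hF K n).2 (h _)⟩
  have := (hF K (-n)).1 (h (-n))
  rwa [neg_neg] at this

lemma Detects.exactComplexes_iff (X : Ho T) :
    exactComplexes I.toMorphismIdeal X ↔ ∀ n, IsZero ((relHomology F n).obj X) := by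
  rw [hF.exactComplexes_eq, ObjectProperty.prop_inverseImage_iff,
    HomotopyCategory.mem_subcategoryAcyclic_iff]
  rfl

lemma Detects.trW_iff {X Y : Ho T} (s : X ⟶ Y) :
    (exactComplexes I.toMorphismIdeal).trW s ↔ ∀ n, IsIso ((relHomology F n).map s) := by
  rw [hF.exactComplexes_eq, ObjectProperty.inverseImage_trW_iff]
  exact (HomotopyCategory.homologyFunctor A (ComplexShape.up ℤ)
    0).mem_homologicalKernel_trW_iff _

lemma Detects.isInvertedBy (n : ℤ) :
    (exactComplexes I.toMorphismIdeal).trW.IsInvertedBy (relHomology F n) :=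
  fun _ _ s hs => (hF.trW_iff s).1 hs n

/-- Relative homology is invariant under isomorphisms in the derived category. -/
lemma Detects.isZero_of_iso {X Y : Ho T}
    (e : (exactComplexes I.toMorphismIdeal).trW.Q.obj X ≅
      (exactComplexes I.toMorphismIdeal).trW.Q.obj Y) (n : ℤ)
    (h : IsZero ((relHomology F n).obj X)) : IsZero ((relHomology F n).obj Y) := by
  let W := (exactComplexes I.toMorphismIdeal).trW
  let φ := Localization.fac (relHomology F n) (hF.isInvertedBy n) W.Q
  exact h.of_iso (φ.symm.app Y ≪≫ (Localization.lift (relHomology F n) (hF.isInvertedBy n)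
    W.Q).mapIso e.symm ≪≫ φ.app X)

/-- The definition only asks for some exact representative; invariance of relative homology lets the
condition be tested on any representative. -/
lemma Detects.derGE_iff (n : ℤ) (X : Ho T) :
    derGE I n ((exactComplexes I.toMorphismIdeal).trW.Q.obj X) ↔
      ∀ m, -n < m → IsZero ((relHomology F m).obj X) := by
  constructor
  · rintro ⟨K, ⟨e⟩, hK⟩ m hm
    have := (hF K (-m)).1 (hK (-m) (by lia))
    rw [neg_neg] at this
    exact hF.isZero_of_iso e.symm m this
  · intro h
    obtain ⟨K, rfl⟩ := HomotopyCategory.quotient_obj_surjective X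
    exact ⟨K, ⟨Iso.refl _⟩, fun m hm => (hF K m).2 (h _ (by lia))⟩

lemma Detects.derLE_iff (n : ℤ) (X : Ho T) :
    derLE I n ((exactComplexes I.toMorphismIdeal).trW.Q.obj X) ↔
      ∀ m, m < -n → IsZero ((relHomology F m).obj X) := by
  constructor
  · rintro ⟨K, ⟨e⟩, hK⟩ m hm
    have := (hF K (-m)).1 (hK (-m) (by lia))
    rw [neg_neg] at this
    exact hF.isZero_of_iso e.symm m this
  · intro h
    obtain ⟨K, rfl⟩ := HomotopyCategory.quotient_obj_surjective X
    exact ⟨K, ⟨Iso.refl _⟩, fun m hm => (hF K m).2 (h _ (by lia))⟩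

end

lemma HomologicalIdeal.exists_detects (I : HomologicalIdeal.{w', w} T) :
    ∃ (A : Type w) (_ : Category.{w'} A) (_ : Abelian A) (F : T ⥤ A) (_ : F.IsHomological),
      Detects F I.toMorphismIdeal := by
  obtain ⟨A, _, _, S, F, _, ⟨e⟩, hI⟩ := I.isHomological
  refine ⟨A, inferInstance, inferInstance, F, inferInstance, fun K n => ?_⟩
  rw [isExactInDegree_iff S F e hI, isZero_relHomology_iff]

/-- The localization functor from the homotopy category to the derived category. -/
abbrev Der.Q (I : HomologicalIdeal.{w', w} T) : Ho T ⥤ Der I :=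
  (exactComplexes I.toMorphismIdeal).trW.Q

/-! ### The axioms of a t-structure -/

section

variable (I : HomologicalIdeal.{w', w} T)

instance (n : ℤ) : (derGE I n).IsClosedUnderIsomorphisms where
  of_iso := by
    rintro X Y e ⟨K, ⟨e'⟩, hK⟩
    exact ⟨K, ⟨e.symm ≪≫ e'⟩, hK⟩

instance (n : ℤ) : (derLE I n).IsClosedUnderIsomorphisms where
  of_iso := by
    rintro X Y e ⟨K, ⟨e'⟩, hK⟩
    exact ⟨K, ⟨e.symm ≪≫ e'⟩, hK⟩

lemma derGE_antitone : Antitone (derGE I) := by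
  rintro m n h X ⟨K, e, hK⟩
  exact ⟨K, e, fun i hi => hK i (by lia)⟩

lemma derLE_monotone : Monotone (derLE I) := by
  rintro m n h X ⟨K, e, hK⟩
  exact ⟨K, e, fun i hi => hK i (by lia)⟩

variable {I} {A : Type w} [Category.{w'} A] [Abelian A] {F : T ⥤ A} [F.IsHomological]
  (hF : Detects F I.toMorphismIdeal)

include hF

lemma Detects.derGE_shift {n a n' : ℤ} (h : n + a = n') {X : Der I} (hX : derGE I n X) :
    derGE I n' (X⟦a⟧) := by
  obtain ⟨K, ⟨e⟩, hK⟩ := hX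
  have hX' := (hF.derGE_iff n ((HomotopyCategory.quotient T _).obj K)).1 ⟨K, ⟨Iso.refl _⟩, hK⟩
  refine (derGE I n').prop_of_iso
    (((Der.Q I).commShiftIso a).app _ ≪≫ (shiftFunctor _ a).mapIso e.symm)
    ((hF.derGE_iff n' _).2 fun m hm => ?_)
  exact (hX' (a + m) (by lia)).of_iso (relHomologyShiftIso F _ a m _ rfl)

lemma Detects.derLE_shift {n a n' : ℤ} (h : n + a = n') {X : Der I} (hX : derLE I n X) :
    derLE I n' (X⟦a⟧) := by
  obtain ⟨K, ⟨e⟩, hK⟩ := hX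
  have hX' := (hF.derLE_iff n ((HomotopyCategory.quotient T _).obj K)).1 ⟨K, ⟨Iso.refl _⟩, hK⟩
  refine (derLE I n').prop_of_iso
    (((Der.Q I).commShiftIso a).app _ ≪≫ (shiftFunctor _ a).mapIso e.symm)
    ((hF.derLE_iff n' _).2 fun m hm => ?_)
  exact (hX' (a + m) (by lia)).of_iso (relHomologyShiftIso F _ a m _ rfl)

omit hF in
/-- Every complex `K` maps to a complex without relative homology in nonpositive degrees, by a
morphism that is invertible on relative homology in positive degrees. Up to homotopy, it is weakly
initial among the morphisms from `K` to complexes whose cycles lift in negative degrees. -/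
lemma exists_truncation (F : T ⥤ A) [F.IsHomological] (K : CochainComplex T ℤ) :
    ∃ (L : CochainComplex T ℤ) (π : K ⟶ L),
      (∀ i, i < 0 → L.HasCycleLifts i (i + 1) (i + 1 + 1)) ∧
      (∀ n ≤ 0, IsZero ((relHomology F n).obj ((HomotopyCategory.quotient T _).obj L))) ∧
      (∀ n, 0 < n → IsIso ((relHomology F n).map ((HomotopyCategory.quotient T _).map π))) ∧
      ∀ (M : CochainComplex T ℤ) (_ : ∀ i, i < 0 → M.HasCycleLifts i (i + 1) (i + 1 + 1))
        (f : (HomotopyCategory.quotient T _).obj K ⟶ (HomotopyCategory.quotient T _).obj M),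
        ∃ g, f = (HomotopyCategory.quotient T (ComplexShape.up ℤ)).map π ≫ g := by
  obtain ⟨L, π, hπ, hL⟩ := K.exists_weakTrunc
  refine ⟨L, π, hL, fun n hn => ?_, fun n hn => ?_, fun M hM f => ?_⟩
  · apply isZero_relHomology_of_hasCycleLifts
    obtain ⟨m, rfl⟩ : ∃ m, n = m + 1 := ⟨n - 1, by lia⟩
    rw [add_sub_cancel_right]
    exact hL m (by lia)
  · exact isIso_relHomology_map F π n (hπ _ (by lia)) (hπ _ (by lia)) (hπ _ (by lia))
  · obtain ⟨f, rfl⟩ := (HomotopyCategory.quotient T _).map_surjective f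
    obtain ⟨g, ⟨h⟩⟩ := CochainComplex.exists_factorization_up_to_homotopy π hπ f hM
    refine ⟨(HomotopyCategory.quotient T _).map g, ?_⟩
    rw [← Functor.map_comp]
    exact (HomotopyCategory.eq_of_homotopy _ _ h).symm

/-- The zero endomorphism of `X` induces isomorphisms on the vanishing homology, so it becomes
invertible in `Der`. -/
lemma Detects.isZero_Q_obj (X : Ho T) (hX : ∀ n, IsZero ((relHomology F n).obj X)) :
    IsZero ((Der.Q I).obj X) := by
  have := Localization.inverts (Der.Q I) _ (0 : X ⟶ X)
    ((hF.trW_iff _).2 fun n => ⟨0, (hX n).eq_of_src _ _, (hX n).eq_of_src _ _⟩)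
  rw [Functor.map_zero] at this
  exact (IsZero.iff_id_eq_zero _).2 (isIsoZeroSelfEquiv _ this)

lemma Detects.hom_eq_zero {X Y : Der I} (f : X ⟶ Y) (hX : derGE I 0 X) (hY : derLE I (-1) Y) :
    f = 0 := by
  obtain ⟨K, ⟨eX⟩, hK⟩ := hX
  obtain ⟨L, ⟨eY⟩, hL⟩ := hY
  obtain ⟨L', π, hL', hL'₀, hπ, -⟩ := exists_truncation F L
  have hL₀ := (hF.derLE_iff (-1) ((HomotopyCategory.quotient T _).obj L)).1
    ⟨L, ⟨Iso.refl _⟩, hL⟩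
  -- In degrees `≤ 0` the homology of both `L` and `L'` vanishes, so `π` becomes invertible in
  -- `Der`.
  have hπ' : (exactComplexes I.toMorphismIdeal).trW ((HomotopyCategory.quotient T _).map π) := by
    rw [hF.trW_iff]
    intro n
    by_cases hn : 0 < n
    · exact hπ n hn
    · exact ⟨0, (hL₀ n (by lia)).eq_of_src _ _, (hL'₀ n (by lia)).eq_of_src _ _⟩
  have := Localization.inverts (Der.Q I) _ _ hπ'
  let g := eX.inv ≫ f ≫ eY.hom ≫ (Der.Q I).map ((HomotopyCategory.quotient T _).map π)
  suffices g = 0 by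
    rw [← cancel_epi eX.inv, ← cancel_mono eY.hom,
      ← cancel_mono ((Der.Q I).map ((HomotopyCategory.quotient T _).map π))]
    simpa [g] using this
  obtain ⟨φ, hφ⟩ := Localization.exists_rightFraction (Der.Q I)
    (exactComplexes I.toMorphismIdeal).trW g
  have hg : (Der.Q I).map φ.s ≫ g = (Der.Q I).map φ.f := by
    rw [hφ, MorphismProperty.RightFraction.map_s_comp_map]
  obtain @⟨K', s, hs, a⟩ := φ
  have := Localization.inverts (Der.Q I) _ _ hs
  obtain ⟨K', rfl⟩ := HomotopyCategory.quotient_obj_surjective K'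
  -- The denominator `s` is invertible in `Der`, so `K'` inherits the vanishing of homology in
  -- positive degrees.
  have hK' := (hF.derGE_iff 0 _).1 ((derGE I 0).prop_of_iso
    (asIso ((Der.Q I).map s)).symm ⟨K, ⟨Iso.refl _⟩, hK⟩)
  obtain ⟨M, ρ, -, hM, hρ, hfac⟩ := exists_truncation F K'
  obtain ⟨b, rfl⟩ := hfac L' hL' a
  have hM' : IsZero ((Der.Q I).obj ((HomotopyCategory.quotient T _).obj M)) := by
    refine hF.isZero_Q_obj _ fun n => ?_
    by_cases hn : 0 < n
    · have := hρ n hn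
      exact (hK' n (by lia)).of_iso (asIso ((relHomology F n).map
        ((HomotopyCategory.quotient T _).map ρ))).symm
    · exact hM n (by lia)
  rw [← cancel_epi ((Der.Q I).map s), comp_zero]
  refine (hg.trans ((Der.Q I).map_comp _ _)).trans ?_
  exact (hM'.eq_of_tgt ((Der.Q I).map ((HomotopyCategory.quotient T _).map ρ)) 0 =≫
    (Der.Q I).map b).trans zero_comp

lemma Detects.exists_triangle (X : Der I) :
    ∃ (Y Z : Der I) (_ : derGE I 0 Y) (_ : derLE I (-1) Z) (f : Y ⟶ X) (g : X ⟶ Z)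
      (h : Z ⟶ Y⟦(1 : ℤ)⟧), Triangle.mk f g h ∈ distTriang (Der I) := by
  obtain ⟨X, rfl⟩ := Localization.Construction.objEquiv _ |>.surjective X
  obtain ⟨K, rfl⟩ := HomotopyCategory.quotient_obj_surjective X
  obtain ⟨L, π, -, hL, hπ, -⟩ := exists_truncation F K
  obtain ⟨Y, a, b, ht⟩ :=
    distinguished_cocone_triangle₁ ((HomotopyCategory.quotient T _).map π)
  refine ⟨(Der.Q I).obj Y, (Der.Q I).obj ((HomotopyCategory.quotient T _).obj L),
    (hF.derGE_iff 0 _).2 fun m hm => ?_, (hF.derLE_iff (-1) _).2 fun m hm => hL m (by lia),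
    _, _, _, (Der.Q I).map_distinguished _ ht⟩
  have := hπ m (by lia)
  refine isZero_relHomology_obj₁ F ht (m - 1) m (by lia) ?_ (inferInstanceAs (Mono
    ((relHomology F m).map ((HomotopyCategory.quotient T _).map π))))
  -- For `m = 1` the map `π` need not be invertible on homology in degree 0, but its target vanishes
  -- there.
  by_cases hm' : m = 1
  · exact ⟨fun _ _ _ => (hL (m - 1) (by lia)).eq_of_src _ _⟩
  · have := hπ (m - 1) (by lia)
    exact inferInstanceAs (Epi ((relHomology F (m - 1)).map
      ((HomotopyCategory.quotient T _).map π)))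

end

end RelHomAlg

end

theorem theorem3 {T : Type u} [Category.{v} T] [Preadditive T] [HasZeroObject T] [HasShift T ℤ]
    [∀ n : ℤ, (shiftFunctor T n).Additive] [Pretriangulated T] [IsTriangulated T]
    (I : RelHomAlg.HomologicalIdeal.{w', w} T) :
    ∃ t : TStructure (RelHomAlg.Der I),
      ∀ n : ℤ, t.le (-n) = RelHomAlg.derGE I n ∧ t.ge (-n) = RelHomAlg.derLE I n := by
  obtain ⟨A, _, _, F, _, hF⟩ := I.exists_detects
  exact ⟨{
    -- `TStructure` is indexed cohomologically, which reverses both the sign of the degree and the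
    -- inequalities.
    le n := RelHomAlg.derGE I (-n)
    ge n := RelHomAlg.derLE I (-n)
    le_shift n a n' h X hX := hF.derGE_shift (by lia) hX
    ge_shift n a n' h X hX := hF.derLE_shift (by lia) hX
    zero' X Y f hX hY := hF.hom_eq_zero f hX hY
    le_zero_le := RelHomAlg.derGE_antitone I (by lia)
    ge_one_le := RelHomAlg.derLE_monotone I (by lia)
    exists_triangle_zero_one := hF.exists_triangle }, fun n => by simp⟩
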